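/- Fix $\delta\in(0,1)$, $K>0$ and $c_2>0$. For each $n$, let $A$ be an $n\times n$ random matrix with entries $A_{ij}=\xi_{ij}\delta_{ij}$, where all the $\xi_{ij}$ and $\delta_{ij}$ are jointly independent, each $\xi_{ij}$ is standard complex Gaussian ($\xi_{ij}\sim\mathcal N_{\mathbb C}(0,1)$, mean $0$ and variance $1$, with independent real and imaginary parts of variance $1/2$), and each $\delta_{ij}$ is Bernoulli with $\mathbb P[\delta_{ij}=1]=n^{\delta-1}$ and $\mathbb P[\delta_{ij}=0]=1-n^{\delta-1}$. For $\varepsilon_1,\varepsilon_2>0$ let $$\mathcal S_{HC}=\Big\{x\in\mathbb C^n:\ \|x\|_2=1,\ \sum_{i:\,|x_i|^2\le \frac1{c_2n^{1-\delta}}}|x_i|^2<\varepsilon_1+\varepsilon_2\Big\}$$ be the set of highly compressible unit vectors. Then there is $\varepsilon_0>0$, depending only on $\delta,K,c_2$, such that for all $\varepsilon_1,\varepsilon_2>0$ with $\varepsilon_1+\varepsilon_2\le\varepsilon_0$ there is a constant $c>0$ such that for all sufficiently large $n$ and all $0\le\varepsilon\le1$, $$\mathbb P\Big[\inf_{x\in\mathcal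 S_{HC}}\|Ax\|_2\le\varepsilon\ \text{ and }\ \|A\|_{op}\le Kn^{\delta/2}\Big]\le e^{-cn^\delta}.$$ Here $\|A\|_{op}$ is the operator norm with respect to $\|\cdot\|_2$; the constant $c$ and the threshold for $n$ do not depend on $\varepsilon$. -/

import Mathlib

open MeasureTheory ProbabilityTheory

/-- The standard complex normal distribution `N_ℂ(0,1)` (mean `0`, variance `1`): real and imaginary
parts are independent real Gaussians of mean `0` and variance `1/2`. -/
noncomputable def complexGaussian : Measure ℂ :=
  ((gaussianReal 0 (1 / 2)).prod (gaussianReal 0 (1 / 2))).map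
    (fun z : ℝ × ℝ => (⟨z.1, z.2⟩ : ℂ))

/-- The Bernoulli distribution with values `0, 1` in `ℂ` which gives mass `n ^ (δ - 1)` to `1`.
For `n ≥ 1` and `δ ≤ 1` one has `n ^ (δ - 1) ∈ [0, 1]`, so the projection to `[0, 1]` does
nothing. -/
noncomputable def sparseBernoulli (δ : ℝ) (n : ℕ) : Measure ℂ :=
  bernoulliMeasure (1 : ℂ) 0 (Set.projIcc (0 : ℝ) 1 zero_le_one ((n : ℝ) ^ (δ - 1)))

/-- `A` is an `n × n` random matrix with entries `A i j = ξ i j * b i j`, where all `ξ i j` and all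
`b i j` are jointly independent, `ξ i j ∼ N_ℂ(0,1)`, and `b i j` is Bernoulli with parameter
`n ^ (δ - 1)`. -/
def IsSparseGaussianMatrix {Ω : Type*} [MeasurableSpace Ω] (P : Measure Ω) (δ : ℝ) {n : ℕ}
    (A : Ω → Matrix (Fin n) (Fin n) ℂ) : Prop :=
  ∃ ξ b : Fin n × Fin n → Ω → ℂ,
    (∀ k, HasLaw (ξ k) complexGaussian P) ∧
    (∀ k, HasLaw (b k) (sparseBernoulli δ n) P) ∧
    iIndepFun (Sum.elim ξ b) P ∧
    ∀ ω i j, A ω i j = ξ (i, j) ω * b (i, j) ω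

/-- The highly compressible unit vectors of `ℂⁿ`: the coordinates with
`|x i|² ≤ 1 / (c₂ n ^ (1 - δ))` carry mass less than `ε₁ + ε₂`. -/
def highlyCompressible (δ c₂ ε₁ ε₂ : ℝ) (n : ℕ) : Set (EuclideanSpace ℂ (Fin n)) :=
  {x | ‖x‖ = 1 ∧
    ∑ i with ‖x i‖ ^ 2 ≤ 1 / (c₂ * (n : ℝ) ^ (1 - δ)), ‖x i‖ ^ 2 < ε₁ + ε₂}

/-- The infimum of `‖A x‖₂` over `x ∈ S`, taken in `[0, ∞]`. -/
noncomputable def infNorm {n : ℕ} (A : Matrix (Fin n) (Fin n) ℂ)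
    (S : Set (EuclideanSpace ℂ (Fin n))) : ENNReal :=
  ⨅ x ∈ S, ‖Matrix.toEuclideanCLM (𝕜 := ℂ) A x‖ₑ

/-- The `ℓ² → ℓ²` operator norm of a matrix. -/
noncomputable def opNorm {n : ℕ} (A : Matrix (Fin n) (Fin n) ℂ) : ℝ :=
  ‖Matrix.toEuclideanCLM (𝕜 := ℂ) A‖

/-! Let `p = n ^ (δ - 1)`. The mass `lowMass k x` below level `1 / k` is `1` at `k = 1`, while on
the highly compressible set it is less than `ε₁ + ε₂` at `k = c₂ n ^ (1 - δ)`. Between these values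
of `k` lie boundedly many scales, each at most `n ^ (δ / 2)` times the previous one. With thresholds
`κ ^ s`, every such vector has a consecutive pair `k, k'` where the mass drops from at least `θ = κ
^ s` to below `κ θ`.

For such a pair, `x` is within about `√(κ θ)` of a vector with at most `k' ≤ k n ^ (δ / 2)` nonzero
coordinates taken from a grid (`exists_sparseVector_approx`), so `exp (O(k' log n))` net points
suffice. A net point that keeps the mass of `x` between the two levels has small ball probability
`exp (-const * k θ n ^ δ)` (`IsSparseGaussianMatrix.measure_norm_sq_le`), which beats the net.
Choosing `κ` small in terms of `K` and `c₂` makes the approximation error `K n ^ (δ / 2) √(κ θ)`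
harmless (`sq_image_bound`).

The small ball bound is Markov's inequality for `exp (-k ∑ (Re (A y)ᵢ)²)`. Writing this as a
Gaussian average of characters factorizes the expectation over the entries. Each row contributes the
average over a real Gaussian `g` of `∏ⱼ (1 - p + p exp (-k g² |yⱼ|² / 2))`, which is bounded through
`p ∑ⱼ min (k |yⱼ|²) 1`. -/

section

/-! ### Laplace transform of the image of a fixed vector -/

instance isProbabilityMeasure_complexGaussian : IsProbabilityMeasure complexGaussian := by
  unfold complexGaussian
  refine Measure.isProbabilityMeasure_map ?_
  exact (Complex.measurableEquivRealProd.symm.measurable).aemeasurable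

instance isProbabilityMeasure_sparseBernoulli (δ : ℝ) (n : ℕ) :
    IsProbabilityMeasure (sparseBernoulli δ n) := by
  unfold sparseBernoulli
  infer_instance

theorem integral_cexp_gaussianReal (v : NNReal) (t : ℝ) :
    ∫ x, Complex.exp (t * x * Complex.I) ∂(gaussianReal 0 v) = Real.exp (-(v * t ^ 2 / 2)) := by
  have h := charFun_gaussianReal (μ := 0) (v := v) t
  rw [charFun_apply_real] at h
  rw [h]
  push_cast
  congr 1
  ring

/-- The characteristic function of the standard complex Gaussian. -/
theorem integral_cexp_complexGaussian (t : ℝ) (w : ℂ) :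
    ∫ z, Complex.exp (t * (z * w).re * Complex.I) ∂complexGaussian
      = Real.exp (-(t ^ 2 * ‖w‖ ^ 2 / 4)) := by
  unfold complexGaussian
  rw [integral_map]
  · have : ∀ z : ℝ × ℝ, Complex.exp (t * (((⟨z.1, z.2⟩ : ℂ) * w).re : ℝ) * Complex.I)
        = Complex.exp ((t * w.re : ℝ) * z.1 * Complex.I)
          * Complex.exp ((-(t * w.im) : ℝ) * z.2 * Complex.I) := by
      intro z
      rw [← Complex.exp_add, Complex.mul_re]
      congr 1
      push_cast
      ring
    simp_rw [this]
    rw [integral_prod_mul (f := fun x : ℝ => Complex.exp ((t * w.re : ℝ) * x * Complex.I))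
      (g := fun x : ℝ => Complex.exp ((-(t * w.im) : ℝ) * x * Complex.I)),
      integral_cexp_gaussianReal, integral_cexp_gaussianReal, ← Complex.ofReal_mul, ← Real.exp_add,
      Complex.sq_norm, Complex.normSq_apply]
    congr 2
    push_cast
    ring
  · exact (Complex.measurableEquivRealProd.symm.measurable).aemeasurable
  · fun_prop

theorem integral_sparseBernoulli {δ : ℝ} (hδ1 : δ < 1) {n : ℕ} (hn : 1 ≤ n) (f : ℂ → ℝ) :
    ∫ z, f z ∂(sparseBernoulli δ n)
      = (n : ℝ) ^ (δ - 1) * f 1 + (1 - (n : ℝ) ^ (δ - 1)) * f 0 := by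
  have hmem : (n : ℝ) ^ (δ - 1) ∈ Set.Icc (0 : ℝ) 1 :=
    ⟨by positivity, Real.rpow_le_one_of_one_le_of_nonpos (by exact_mod_cast hn) (by linarith)⟩
  unfold sparseBernoulli
  rw [integral_bernoulliMeasure, Set.projIcc_of_mem _ hmem]
  simp

variable {n : ℕ}

/-- Linearization of the Gaussian square: `exp (-k ∑ Xᵢ²)` is a Gaussian average of characters. -/
theorem exp_neg_sum_sq_eq_integral {k : ℝ} (hk : 0 ≤ k) (X : Fin n → ℝ) :
    ((Real.exp (-(k * ∑ i, X i ^ 2)) : ℝ) : ℂ)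
      = ∫ g : Fin n → ℝ, ∏ i, Complex.exp ((√(2 * k) * X i : ℝ) * g i * Complex.I)
          ∂(Measure.pi fun _ => gaussianReal 0 1) := by
  rw [integral_fintype_prod_eq_prod
    (f := fun i (g : ℝ) => Complex.exp ((√(2 * k) * X i : ℝ) * g * Complex.I))]
  simp_rw [integral_cexp_gaussianReal]
  rw [← Complex.ofReal_prod, ← Real.exp_sum]
  congr 2
  rw [Finset.mul_sum, ← Finset.sum_neg_distrib]
  refine Finset.sum_congr rfl fun i _ => ?_
  rw [mul_pow, Real.sq_sqrt (by positivity)]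
  push_cast
  ring

/-- Once the square is linearized by one Gaussian `g i` per row, the integrand is a product of
unimodular characters in the separate entries. Fubini then lets each entry be replaced by its
characteristic function. -/
theorem integral_exp_neg_sum_re_sq_complexGaussian {k : ℝ} (hk : 0 ≤ k)
    (a : Fin n × Fin n → ℂ) :
    ∫ ξ : Fin n × Fin n → ℂ, Real.exp (-(k * ∑ i, (∑ j, ξ (i, j) * a (i, j)).re ^ 2))
        ∂(Measure.pi fun _ => complexGaussian)
      = ∫ g : Fin n → ℝ, ∏ l : Fin n × Fin n, Real.exp (-(k * g l.1 ^ 2 * ‖a l‖ ^ 2 / 2))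
          ∂(Measure.pi fun _ => gaussianReal 0 1) := by
  have key : ∀ (ξ : Fin n × Fin n → ℂ) (g : Fin n → ℝ),
      ∏ i, Complex.exp ((√(2 * k) * (∑ j, ξ (i, j) * a (i, j)).re : ℝ) * g i * Complex.I)
        = ∏ l : Fin n × Fin n,
          Complex.exp ((√(2 * k) * g l.1 : ℝ) * (ξ l * a l).re * Complex.I) := by
    intro ξ g
    rw [Fintype.prod_prod_type]
    refine Finset.prod_congr rfl fun i _ => ?_
    rw [← Complex.exp_sum, Complex.re_sum]
    congr 1
    push_cast
    rw [Finset.mul_sum, Finset.sum_mul, Finset.sum_mul]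
    refine Finset.sum_congr rfl fun j _ => ?_
    ring
  apply Complex.ofReal_injective
  rw [← integral_complex_ofReal, ← integral_complex_ofReal]
  simp_rw [exp_neg_sum_sq_eq_integral hk, key]
  rw [integral_integral_swap]
  · refine integral_congr_ae (Filter.Eventually.of_forall fun g => ?_)
    simp only
    rw [integral_fintype_prod_eq_prod
      (f := fun l (z : ℂ) => Complex.exp ((√(2 * k) * g l.1 : ℝ) * (z * a l).re * Complex.I))]
    simp_rw [integral_cexp_complexGaussian]
    rw [← Complex.ofReal_prod]
    congr 1
    refine Finset.prod_congr rfl fun l _ => ?_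
    rw [mul_pow, Real.sq_sqrt (by positivity)]
    congr 1
    ring
  · refine Integrable.of_bound (C := 1) ?_ (Filter.Eventually.of_forall fun q => ?_)
    · refine Measurable.aestronglyMeasurable ?_
      simp only [Function.uncurry_def]
      fun_prop
    · simp only [Function.uncurry_def, norm_prod]
      refine Finset.prod_le_one (fun _ _ => norm_nonneg _) fun l _ => ?_
      rw [← Complex.ofReal_mul, Complex.norm_exp_ofReal_mul_I]

/-- The expectation `𝔼 exp (-k ∑ᵢ (Re (A y)ᵢ)²)` for a sparse Gaussian matrix `A`. -/
theorem IsSparseGaussianMatrix.integral_exp_neg_sum_re_sq {Ω : Type*} [MeasurableSpace Ω]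
    {P : Measure Ω} [IsProbabilityMeasure P] {δ : ℝ} (hδ1 : δ < 1)
    {A : Ω → Matrix (Fin n) (Fin n) ℂ} (hA : IsSparseGaussianMatrix P δ A) (hn : 1 ≤ n)
    {k : ℝ} (hk : 0 ≤ k) (y : Fin n → ℂ) :
    AEMeasurable (fun ω => Real.exp (-(k * ∑ i, ((A ω).mulVec y i).re ^ 2))) P ∧
    ∫ ω, Real.exp (-(k * ∑ i, ((A ω).mulVec y i).re ^ 2)) ∂P
      = (∫ g : ℝ, ∏ j, ((n : ℝ) ^ (δ - 1) * Real.exp (-(k * g ^ 2 * ‖y j‖ ^ 2 / 2))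
          + (1 - (n : ℝ) ^ (δ - 1))) ∂(gaussianReal 0 1)) ^ n := by
  obtain ⟨ξ, b, hξ, hb, hind, hAξ⟩ := hA
  let F : (Fin n × Fin n → ℂ) × (Fin n × Fin n → ℂ) → ℝ := fun z =>
    Real.exp (-(k * ∑ i, (∑ j, z.1 (i, j) * (z.2 (i, j) * y j)).re ^ 2))
  have hF : Measurable F := by fun_prop
  let μ : (Fin n × Fin n) ⊕ (Fin n × Fin n) → Measure ℂ :=
    Sum.elim (fun _ => complexGaussian) (fun _ => sparseBernoulli δ n)
  have hμ : ∀ s, IsProbabilityMeasure (μ s) := by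
    rintro (s | s)
    · exact isProbabilityMeasure_complexGaussian
    · exact isProbabilityMeasure_sparseBernoulli δ n
  have hlaw : HasLaw (fun ω s => Sum.elim ξ b s ω) (Measure.pi μ) P := by
    refine hind.hasLaw_pi ?_
    rintro (s | s)
    · exact hξ s
    · exact hb s
  have hlaw' := (measurePreserving_sumPiEquivProdPi (X := fun _ => ℂ) μ).fun_comp_hasLaw hlaw
  have hF_eq : ∀ ω, Real.exp (-(k * ∑ i, ((A ω).mulVec y i).re ^ 2))
      = F (MeasurableEquiv.sumPiEquivProdPi (fun _ => ℂ) fun s => Sum.elim ξ b s ω) := by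
    intro ω
    simp only [F, Matrix.mulVec, dotProduct, hAξ, mul_assoc]
    rfl
  simp_rw [hF_eq]
  refine ⟨hF.comp_aemeasurable hlaw'.aemeasurable, ?_⟩
  have h1 := hlaw'.integral_comp (f := F) hF.aestronglyMeasurable
  refine h1.trans ?_
  have hFb : ∀ z, ‖F z‖ ≤ 1 := by
    intro z
    rw [Real.norm_eq_abs, abs_of_pos (Real.exp_pos _), Real.exp_le_one_iff]
    exact neg_nonpos.2 (mul_nonneg hk (Finset.sum_nonneg fun _ _ => sq_nonneg _))
  have hexp : ∀ (c r : ℝ), 0 ≤ r → Real.exp (-(k * c ^ 2 * r / 2)) ≤ 1 := by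
    intro c r hr
    rw [Real.exp_le_one_iff]
    exact neg_nonpos.2 (by positivity)
  -- The Gaussian entries are integrated first, with the Bernoulli variables frozen; afterwards the
  -- Bernoulli average is taken inside the `g`-integral, where it factors over entries and the rows
  -- become identical.
  rw [integral_prod_symm _ (Integrable.of_bound hF.aestronglyMeasurable 1
    (Filter.Eventually.of_forall hFb))]
  simp only [F, μ, Sum.elim_inl, Sum.elim_inr]
  simp_rw [integral_exp_neg_sum_re_sq_complexGaussian hk (fun l => _ * y l.2)]
  rw [integral_integral_swap]
  · have : ∀ g : Fin n → ℝ,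
        ∫ z : Fin n × Fin n → ℂ, ∏ l : Fin n × Fin n,
          Real.exp (-(k * g l.1 ^ 2 * ‖z l * y l.2‖ ^ 2 / 2))
            ∂(Measure.pi fun _ => sparseBernoulli δ n)
        = ∏ i, ∏ j, ((n : ℝ) ^ (δ - 1) * Real.exp (-(k * g i ^ 2 * ‖y j‖ ^ 2 / 2))
          + (1 - (n : ℝ) ^ (δ - 1))) := by
      intro g
      rw [integral_fintype_prod_eq_prod
        (f := fun (l : Fin n × Fin n) (z : ℂ) =>
          Real.exp (-(k * g l.1 ^ 2 * ‖z * y l.2‖ ^ 2 / 2)))]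
      simp_rw [integral_sparseBernoulli hδ1 hn]
      rw [Fintype.prod_prod_type]
      simp
    simp_rw [this]
    rw [integral_fintype_prod_eq_pow
      (f := fun g : ℝ => ∏ j, ((n : ℝ) ^ (δ - 1) * Real.exp (-(k * g ^ 2 * ‖y j‖ ^ 2 / 2))
          + (1 - (n : ℝ) ^ (δ - 1)))), Fintype.card_fin]
  · refine Integrable.of_bound (C := 1) ?_ (Filter.Eventually.of_forall fun q => ?_)
    · refine Measurable.aestronglyMeasurable ?_
      simp only [Function.uncurry_def]
      fun_prop
    · simp only [Function.uncurry_def, norm_prod]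
      refine Finset.prod_le_one (fun _ _ => norm_nonneg _) fun l _ => ?_
      rw [Real.norm_eq_abs, abs_of_pos (Real.exp_pos _)]
      exact hexp _ _ (sq_nonneg _)

end

/-! ### Small ball estimate for a fixed vector -/

section

/-- The probability that a standard real Gaussian has absolute value at least `1`. -/
noncomputable def gaussianTail : ℝ := (gaussianReal 0 1).real {g | 1 ≤ g ^ 2}

theorem gaussianTail_pos : 0 < gaussianTail := by
  unfold gaussianTail
  rw [measureReal_def, ENNReal.toReal_pos_iff]
  refine ⟨pos_iff_ne_zero.2 fun h => ?_, measure_lt_top _ _⟩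
  have h2 : (volume : Measure ℝ) {g : ℝ | 1 ≤ g ^ 2} = 0 :=
    (gaussianReal_absolutelyContinuous' 0 one_ne_zero) h
  have h3 : (volume : Measure ℝ) (Set.Icc 1 2) ≤ 0 := by
    rw [← h2]
    refine measure_mono fun g hg => ?_
    have := hg.1
    simp only [Set.mem_ofPred_eq]
    nlinarith
  rw [Real.volume_Icc] at h3
  norm_num at h3

theorem div_one_add_le_one_sub_exp_neg {a : ℝ} (ha : 0 ≤ a) : a / (1 + a) ≤ 1 - Real.exp (-a) := by
  have h1 : 1 + a ≤ Real.exp a := by linarith [Real.add_one_le_exp a]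
  have h2 : Real.exp (-a) ≤ (1 + a)⁻¹ := by
    rw [Real.exp_neg]
    exact inv_anti₀ (by positivity) h1
  have h3 : a / (1 + a) = 1 - (1 + a)⁻¹ := by
    field_simp
    ring
  linarith

/-- With `m = min t 1`, the bound `a / (1 + a)` at `a = m / 2 ≤ 1 / 2` has denominator at most `3 /
2`, which gives `m / 3`. -/
theorem min_one_div_three_le_one_sub_exp {t u : ℝ} (ht : 0 ≤ t) (hu : t / 2 ≤ u) :
    min t 1 / 3 ≤ 1 - Real.exp (-u) := by
  have hm0 : 0 ≤ min t 1 := le_min ht zero_le_one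
  have hm1 : min t 1 ≤ 1 := min_le_right _ _
  have h1 := div_one_add_le_one_sub_exp_neg (a := min t 1 / 2) (by positivity)
  have h2 : Real.exp (-u) ≤ Real.exp (-(min t 1 / 2)) :=
    Real.exp_le_exp.2 (by linarith [min_le_left t 1])
  have h3 : min t 1 / 3 ≤ min t 1 / 2 / (1 + min t 1 / 2) := by
    rw [le_div_iff₀ (by positivity)]
    nlinarith
  linarith

/-- Truncated mass of a vector at level `1 / k`, rescaled by `k`. -/
noncomputable def truncatedMass {n : ℕ} (k : ℝ) (y : Fin n → ℂ) : ℝ :=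
  ∑ j, min (k * ‖y j‖ ^ 2) 1

variable {n : ℕ}

theorem prod_mixture_le {p k g : ℝ} (hp0 : 0 ≤ p) (hp1 : p ≤ 1) (hk : 0 ≤ k) (hg : 1 ≤ g ^ 2)
    (y : Fin n → ℂ) :
    ∏ j, (p * Real.exp (-(k * g ^ 2 * ‖y j‖ ^ 2 / 2)) + (1 - p))
      ≤ Real.exp (-(p * truncatedMass k y / 3)) := by
  have : -(p * truncatedMass k y / 3) = ∑ j, -(p * (min (k * ‖y j‖ ^ 2) 1 / 3)) := by
    rw [truncatedMass, Finset.mul_sum, Finset.sum_div, ← Finset.sum_neg_distrib]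
    refine Finset.sum_congr rfl fun j _ => ?_
    ring
  rw [this, Real.exp_sum]
  refine Finset.prod_le_prod (fun j _ => ?_) fun j _ => ?_
  · have := Real.exp_pos (-(k * g ^ 2 * ‖y j‖ ^ 2 / 2))
    have := mul_nonneg hp0 this.le
    linarith
  · have h1 : k * ‖y j‖ ^ 2 / 2 ≤ k * g ^ 2 * ‖y j‖ ^ 2 / 2 := by
      have : 0 ≤ k * ‖y j‖ ^ 2 := by positivity
      nlinarith
    have h2 := min_one_div_three_le_one_sub_exp (t := k * ‖y j‖ ^ 2) (by positivity) h1
    have h3 := Real.add_one_le_exp (-(p * (min (k * ‖y j‖ ^ 2) 1 / 3)))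
    have h4 := mul_le_mul_of_nonneg_left h2 hp0
    linarith

theorem prod_mixture_le_one {p k g : ℝ} (hp0 : 0 ≤ p) (hp1 : p ≤ 1) (hk : 0 ≤ k)
    (y : Fin n → ℂ) :
    ∏ j, (p * Real.exp (-(k * g ^ 2 * ‖y j‖ ^ 2 / 2)) + (1 - p)) ≤ 1 := by
  refine Finset.prod_le_one (fun j _ => ?_) fun j _ => ?_
  · have := mul_nonneg hp0 (Real.exp_pos (-(k * g ^ 2 * ‖y j‖ ^ 2 / 2))).le
    linarith
  · have : Real.exp (-(k * g ^ 2 * ‖y j‖ ^ 2 / 2)) ≤ 1 := by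
      rw [Real.exp_le_one_iff]
      exact neg_nonpos.2 (by positivity)
    have := mul_le_mul_of_nonneg_left this hp0
    linarith

/-- On `g² ≥ 1`, an event of constant probability, the product is at most the exponential in the
truncated mass; elsewhere the trivial bound `1` is enough. -/
theorem integral_prod_mixture_le {p k : ℝ} (hp0 : 0 ≤ p) (hp1 : p ≤ 1) (hk : 0 ≤ k)
    (y : Fin n → ℂ) :
    ∫ g : ℝ, ∏ j, (p * Real.exp (-(k * g ^ 2 * ‖y j‖ ^ 2 / 2)) + (1 - p)) ∂(gaussianReal 0 1)
      ≤ 1 - gaussianTail * (1 - Real.exp (-(p * truncatedMass k y / 3))) := by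
  set E := Real.exp (-(p * truncatedMass k y / 3)) with hE
  have hS : MeasurableSet {g : ℝ | 1 ≤ g ^ 2} := measurableSet_le measurable_const (by fun_prop)
  have hint : Integrable ({g : ℝ | 1 ≤ g ^ 2}.indicator fun _ => 1 - E) (gaussianReal 0 1) :=
    (integrable_const _).indicator hS
  have hbound : ∫ g : ℝ, (1 - {g : ℝ | 1 ≤ g ^ 2}.indicator (fun _ => 1 - E) g)
      ∂(gaussianReal 0 1) = 1 - gaussianTail * (1 - E) := by
    rw [integral_sub (integrable_const _) hint, integral_indicator_const _ hS]
    simp [gaussianTail]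
  rw [← hbound]
  refine integral_mono_of_nonneg (Filter.Eventually.of_forall fun g => ?_)
    ((integrable_const _).sub hint) (Filter.Eventually.of_forall fun g => ?_)
  · refine Finset.prod_nonneg fun j _ => ?_
    have := mul_nonneg hp0 (Real.exp_pos (-(k * g ^ 2 * ‖y j‖ ^ 2 / 2))).le
    linarith
  · by_cases hg : 1 ≤ g ^ 2
    · have h : {g : ℝ | 1 ≤ g ^ 2}.indicator (fun _ => 1 - E) g = 1 - E :=
        Set.indicator_of_mem (s := {g : ℝ | 1 ≤ g ^ 2}) hg _
      simp only [h, sub_sub_cancel]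
      exact prod_mixture_le hp0 hp1 hk hg y
    · have h : {g : ℝ | 1 ≤ g ^ 2}.indicator (fun _ => 1 - E) g = 0 :=
        Set.indicator_of_notMem (s := {g : ℝ | 1 ≤ g ^ 2}) hg _
      simp only [h, sub_zero]
      exact prod_mixture_le_one hp0 hp1 hk y

theorem sum_re_sq_mulVec_le (A : Matrix (Fin n) (Fin n) ℂ) (y : EuclideanSpace ℂ (Fin n)) :
    ∑ i, (A.mulVec y i).re ^ 2 ≤ ‖Matrix.toEuclideanCLM (𝕜 := ℂ) A y‖ ^ 2 := by
  rw [EuclideanSpace.norm_sq_eq]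
  refine Finset.sum_le_sum fun i _ => ?_
  rw [Matrix.ofLp_toEuclideanCLM, ← sq_abs]
  exact pow_le_pow_left₀ (abs_nonneg _) (Complex.abs_re_le_norm _) 2

/-- Small ball estimate for a fixed vector. -/
theorem IsSparseGaussianMatrix.measure_norm_sq_le {Ω : Type*} [MeasurableSpace Ω]
    {P : Measure Ω} [IsProbabilityMeasure P] {δ : ℝ} (hδ1 : δ < 1)
    {A : Ω → Matrix (Fin n) (Fin n) ℂ} (hA : IsSparseGaussianMatrix P δ A) (hn : 1 ≤ n)
    {k : ℝ} (hk : 0 ≤ k) (y : EuclideanSpace ℂ (Fin n)) {r a : ℝ} (ha : 0 ≤ a)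
    (hay : a ≤ (n : ℝ) ^ (δ - 1) * truncatedMass k y / 3) :
    P {ω | ‖Matrix.toEuclideanCLM (𝕜 := ℂ) (A ω) y‖ ^ 2 ≤ r}
      ≤ ENNReal.ofReal (Real.exp (k * r - n * (gaussianTail * (a / (1 + a))))) := by
  obtain ⟨hmeas, hint⟩ := hA.integral_exp_neg_sum_re_sq hδ1 hn hk y
  set f : Ω → ℝ := fun ω => Real.exp (-(k * ∑ i, ((A ω).mulVec y i).re ^ 2)) with hf
  have hp0 : 0 ≤ (n : ℝ) ^ (δ - 1) := by positivity
  have hp1 : (n : ℝ) ^ (δ - 1) ≤ 1 :=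
    Real.rpow_le_one_of_one_le_of_nonpos (by exact_mod_cast hn) (by linarith)
  have hfi : Integrable f P := by
    refine Integrable.of_bound hmeas.aestronglyMeasurable 1 (Filter.Eventually.of_forall fun ω => ?_)
    rw [Real.norm_eq_abs, abs_of_pos (Real.exp_pos _), Real.exp_le_one_iff]
    exact neg_nonpos.2 (mul_nonneg hk (Finset.sum_nonneg fun _ _ => sq_nonneg _))
  have hle : ∫ ω, f ω ∂P ≤ Real.exp (-(n * (gaussianTail * (a / (1 + a))))) := by
    rw [hint]
    have h1 := integral_prod_mixture_le hp0 hp1 hk y (n := n)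
    have h2 := div_one_add_le_one_sub_exp_neg ha
    have h3 : Real.exp (-((n : ℝ) ^ (δ - 1) * truncatedMass k y / 3)) ≤ Real.exp (-a) :=
      Real.exp_le_exp.2 (by linarith)
    have h4 := mul_le_mul_of_nonneg_left (h2.trans (sub_le_sub_left h3 1)) gaussianTail_pos.le
    have h5 := Real.add_one_le_exp (-(gaussianTail * (a / (1 + a))))
    calc _ ≤ (Real.exp (-(gaussianTail * (a / (1 + a))))) ^ n := by
          refine pow_le_pow_left₀ (integral_nonneg fun g => Finset.prod_nonneg fun j _ => ?_)
            (by linarith) n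
          have := mul_nonneg hp0 (Real.exp_pos (-(k * g ^ 2 * ‖y j‖ ^ 2 / 2))).le
          linarith
      _ = _ := by rw [← Real.exp_nat_mul]; congr 1; ring
  -- Markov's inequality for `f`: a small image forces `f ≥ exp (-k r)`.
  have hmarkov := mul_meas_ge_le_integral_of_nonneg
    (Filter.Eventually.of_forall fun ω => (Real.exp_pos _).le : 0 ≤ᵐ[P] f) hfi (Real.exp (-(k * r)))
  have hsub : {ω | ‖Matrix.toEuclideanCLM (𝕜 := ℂ) (A ω) y‖ ^ 2 ≤ r}
      ⊆ {ω | Real.exp (-(k * r)) ≤ f ω} := by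
    intro ω hω
    simp only [Set.mem_ofPred_eq] at hω
    refine Real.exp_le_exp.2 (neg_le_neg (mul_le_mul_of_nonneg_left ?_ hk))
    exact (sum_re_sq_mulVec_le _ _).trans hω
  have hreal : P.real {ω | Real.exp (-(k * r)) ≤ f ω}
      ≤ Real.exp (k * r - n * (gaussianTail * (a / (1 + a)))) := by
    have h1 : Real.exp (-(k * r)) * P.real {ω | Real.exp (-(k * r)) ≤ f ω}
      ≤ Real.exp (-(n * (gaussianTail * (a / (1 + a))))) := hmarkov.trans hle
    have h2 : Real.exp (k * r - n * (gaussianTail * (a / (1 + a))))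
        = Real.exp (k * r) * Real.exp (-(n * (gaussianTail * (a / (1 + a))))) := by
      rw [← Real.exp_add]; congr 1
    rw [h2]
    calc _ = Real.exp (k * r) * (Real.exp (-(k * r)) * P.real {ω | Real.exp (-(k * r)) ≤ f ω}) := by
          rw [← mul_assoc, ← Real.exp_add]; simp
      _ ≤ _ := mul_le_mul_of_nonneg_left h1 (Real.exp_pos _).le
  calc P _ ≤ P {ω | Real.exp (-(k * r)) ≤ f ω} := measure_mono hsub
    _ = ENNReal.ofReal (P.real {ω | Real.exp (-(k * r)) ≤ f ω}) := by
      rw [measureReal_def, ENNReal.ofReal_toReal (measure_ne_top _ _)]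
    _ ≤ _ := ENNReal.ofReal_le_ofReal hreal

end

/-! ### Approximation by sparse grid vectors -/

section

/-- The mass of `x` on the coordinates with `|x i|² ≤ 1 / k`. -/
noncomputable def lowMass {n : ℕ} (k : ℝ) (x : EuclideanSpace ℂ (Fin n)) : ℝ :=
  ∑ i with ‖x i‖ ^ 2 ≤ 1 / k, ‖x i‖ ^ 2

/-- The grid of mesh `1 / M` in the square `[-1, 1]²`. -/
noncomputable def gridPoint (M : ℕ) (a : Fin (2 * M + 1) × Fin (2 * M + 1)) : ℂ :=
  ⟨((a.1 : ℝ) - M) / M, ((a.2 : ℝ) - M) / M⟩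

theorem exists_fin_abs_sub_le {M : ℕ} (hM : 1 ≤ M) {r : ℝ} (hr : |r| ≤ 1) :
    ∃ a : Fin (2 * M + 1), |r - ((a : ℝ) - M) / M| ≤ 1 / M := by
  have hM' : (0 : ℝ) < M := by exact_mod_cast hM
  obtain ⟨h1, h2⟩ := abs_le.1 hr
  have h0 : 0 ≤ (r + 1) * M := mul_nonneg (by linarith) hM'.le
  have hfl := Nat.floor_le h0
  have hfl' := Nat.lt_floor_add_one ((r + 1) * M)
  have hlt : ⌊(r + 1) * M⌋₊ < 2 * M + 1 := by
    rw [Nat.floor_lt h0]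
    push_cast
    nlinarith
  refine ⟨⟨_, hlt⟩, ?_⟩
  have : r - ((⌊(r + 1) * M⌋₊ : ℝ) - M) / M = ((r + 1) * M - ⌊(r + 1) * M⌋₊) / M := by
    field_simp
    ring
  simp only [this]
  rw [abs_of_nonneg (div_nonneg (by linarith) hM'.le)]
  gcongr
  linarith

theorem exists_gridPoint_norm_sub_le {M : ℕ} (hM : 1 ≤ M) {z : ℂ} (hz : ‖z‖ ≤ 1) :
    ∃ a, ‖z - gridPoint M a‖ ≤ 2 / M := by
  obtain ⟨a, ha⟩ := exists_fin_abs_sub_le hM ((Complex.abs_re_le_norm z).trans hz)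
  obtain ⟨b, hb⟩ := exists_fin_abs_sub_le hM ((Complex.abs_im_le_norm z).trans hz)
  refine ⟨(a, b), (Complex.norm_le_abs_re_add_abs_im _).trans ?_⟩
  calc _ ≤ 1 / (M : ℝ) + 1 / M := add_le_add ha hb
    _ = 2 / M := by ring

open Classical in
/-- A vector given by a list of positions with grid values. -/
noncomputable def sparseVector {n m M : ℕ}
    (c : Fin m → Fin n × Fin (2 * M + 1) × Fin (2 * M + 1)) : EuclideanSpace ℂ (Fin n) :=
  WithLp.toLp 2 fun j => if h : ∃ l, (c l).1 = j then gridPoint M (c h.choose).2 else 0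

theorem exists_sparseVector_eq {n m M : ℕ} {I : Finset (Fin n)} (hI : I.Nonempty)
    (hm : I.card ≤ m) (F : Fin n → Fin (2 * M + 1) × Fin (2 * M + 1)) :
    ∃ c : Fin m → Fin n × Fin (2 * M + 1) × Fin (2 * M + 1),
      (∀ j ∈ I, sparseVector c j = gridPoint M (F j)) ∧ ∀ j ∉ I, sparseVector c j = 0 := by
  have : Nonempty I := hI.to_subtype
  obtain ⟨e⟩ : Nonempty (I ↪ Fin m) :=
    Function.Embedding.nonempty_of_card_le (by simpa using hm)
  -- Slots outside the range of `e` repeat some position of `I` together with its own value, so the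
  -- arbitrary choice made in `sparseVector` does not affect the coordinate.
  refine ⟨fun l => ((Function.invFun e l : I), F (Function.invFun e l : I)), fun j hj => ?_,
    fun j hj => ?_⟩
  · have h : ∃ l, ((Function.invFun e l : I) : Fin n) = j :=
      ⟨e ⟨j, hj⟩, by rw [Function.leftInverse_invFun e.injective]⟩
    simp only [sparseVector]
    rw [dif_pos h, h.choose_spec]
  · simp only [sparseVector]
    rw [dif_neg]
    rintro ⟨l, rfl⟩
    exact hj (Function.invFun e l).2

variable {n : ℕ}

theorem sub_le_sum_of_lowMass (x : EuclideanSpace ℂ (Fin n)) (k k' : ℝ) :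
    lowMass k x - lowMass k' x
      ≤ ∑ i with ‖x i‖ ^ 2 ≤ 1 / k ∧ 1 / k' < ‖x i‖ ^ 2, ‖x i‖ ^ 2 := by
  have h := Finset.sum_filter_add_sum_filter_not
    (Finset.univ.filter fun i => ‖x i‖ ^ 2 ≤ 1 / k) (fun i => 1 / k' < ‖x i‖ ^ 2)
    (fun i => ‖x i‖ ^ 2)
  rw [Finset.filter_filter, Finset.filter_filter] at h
  have h2 : ∑ i with ‖x i‖ ^ 2 ≤ 1 / k ∧ ¬ 1 / k' < ‖x i‖ ^ 2, ‖x i‖ ^ 2 ≤ lowMass k' x := by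
    refine Finset.sum_le_sum_of_subset_of_nonneg (fun i hi => ?_) fun _ _ _ => sq_nonneg _
    simp only [Finset.mem_filter, Finset.mem_univ, true_and, not_lt] at hi ⊢
    exact hi.2
  have h3 : lowMass k x = ∑ i with ‖x i‖ ^ 2 ≤ 1 / k, ‖x i‖ ^ 2 := rfl
  linarith

theorem norm_coord_le_one {x : EuclideanSpace ℂ (Fin n)} (hx : ‖x‖ = 1) (i : Fin n) :
    ‖x i‖ ≤ 1 := hx ▸ PiLp.norm_apply_le x i

theorem card_large_coords_le {x : EuclideanSpace ℂ (Fin n)} (hx : ‖x‖ = 1) {k : ℝ} (hk : 0 < k) :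
    ((Finset.univ.filter fun i => 1 / k < ‖x i‖ ^ 2).card : ℝ) ≤ k := by
  have h1 : ∑ i, ‖x i‖ ^ 2 = 1 := by rw [← EuclideanSpace.norm_sq_eq, hx, one_pow]
  have h2 : ((Finset.univ.filter fun i => 1 / k < ‖x i‖ ^ 2).card : ℝ) * (1 / k) ≤ 1 := by
    rw [← h1, ← nsmul_eq_mul]
    refine (Finset.card_nsmul_le_sum _ (fun i => ‖x i‖ ^ 2) _ fun i hi => ?_).trans
      (Finset.sum_le_sum_of_subset_of_nonneg (Finset.subset_univ _) fun _ _ _ => sq_nonneg _)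
    exact (Finset.mem_filter.1 hi).2.le
  rwa [mul_one_div, div_le_one hk] at h2

theorem sum_large_coords {x : EuclideanSpace ℂ (Fin n)} (hx : ‖x‖ = 1) (k : ℝ) :
    ∑ i with 1 / k < ‖x i‖ ^ 2, ‖x i‖ ^ 2 = 1 - lowMass k x := by
  have h1 : ∑ i, ‖x i‖ ^ 2 = 1 := by rw [← EuclideanSpace.norm_sq_eq, hx, one_pow]
  have h := Finset.sum_filter_add_sum_filter_not Finset.univ (fun i => 1 / k < ‖x i‖ ^ 2)
    (fun i => ‖x i‖ ^ 2)
  simp only [not_lt] at h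
  have h3 : lowMass k x = ∑ i with ‖x i‖ ^ 2 ≤ 1 / k, ‖x i‖ ^ 2 := rfl
  linarith

/-- A unit vector with little mass on its coordinates below level `1 / k'` is approximated by a
sparse grid vector, which keeps most of the mass of `x` between the levels `1 / k'` and `1 / k`. -/
theorem exists_sparseVector_approx (hn : 1 ≤ n) {x : EuclideanSpace ℂ (Fin n)} (hx : ‖x‖ = 1)
    {k k' θ' : ℝ} (hk : 0 < k) (hk' : 0 < k') (hθ' : θ' < 1) (hlow : lowMass k' x ≤ θ') :
    ∃ c : Fin ⌊k'⌋₊ → Fin n × Fin (2 * n ^ 2 + 1) × Fin (2 * n ^ 2 + 1),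
      k * (lowMass k x - θ' - 8 / n) ≤ truncatedMass k (sparseVector c) ∧
      ‖x - sparseVector c‖ ≤ √θ' + 2 / n := by
  have hn' : (1 : ℝ) ≤ n := by exact_mod_cast hn
  have hn0 : (0 : ℝ) < n := by linarith
  -- With mesh `1 / n²` the rounding errors, summed over up to `n` coordinates, are still `O(1 /
  -- n)`.
  have hM : 1 ≤ n ^ 2 := Nat.one_le_pow _ _ hn
  choose F hF using fun i => exists_gridPoint_norm_sub_le hM (norm_coord_le_one hx i)
  set I := Finset.univ.filter fun i => 1 / k' < ‖x i‖ ^ 2 with hI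
  have hIne : I.Nonempty := by
    rw [Finset.nonempty_iff_ne_empty]
    intro h
    have := sum_large_coords hx k'
    rw [← hI, h, Finset.sum_empty] at this
    linarith
  obtain ⟨c, hc1, hc2⟩ := exists_sparseVector_eq hIne (Nat.le_floor (card_large_coords_le hx hk')) F
  have hθ0 : 0 ≤ θ' := (Finset.sum_nonneg fun _ _ => sq_nonneg _).trans hlow
  have hclose : ∀ j ∈ I, ‖x j - sparseVector c j‖ ≤ 2 / (n : ℝ) ^ 2 := by
    intro j hj
    rw [hc1 j hj]
    simpa using hF j
  refine ⟨c, ?_, ?_⟩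
  · have hterm : ∀ j ∈ Finset.univ.filter fun i => ‖x i‖ ^ 2 ≤ 1 / k ∧ 1 / k' < ‖x i‖ ^ 2,
        k * (‖x j‖ ^ 2 - 8 / (n : ℝ) ^ 2) ≤ min (k * ‖sparseVector c j‖ ^ 2) 1 := by
      intro j hj
      obtain ⟨hj1, hj2⟩ := (Finset.mem_filter.1 hj).2
      have hd := hclose j (Finset.mem_filter.2 ⟨Finset.mem_univ _, hj2⟩)
      have hx1 := norm_coord_le_one hx j
      have hx0 := norm_nonneg (x j)
      have hy0 := norm_nonneg (sparseVector c j)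
      have htri : ‖x j‖ - ‖sparseVector c j‖ ≤ 2 / (n : ℝ) ^ 2 := (norm_sub_norm_le _ _).trans hd
      have he0 : 0 < 2 / (n : ℝ) ^ 2 := by positivity
      have h8 : 8 / (n : ℝ) ^ 2 = 4 * (2 / (n : ℝ) ^ 2) := by ring
      rw [h8]
      refine le_min (mul_le_mul_of_nonneg_left ?_ hk.le) ?_
      · rcases le_total ‖x j‖ ‖sparseVector c j‖ with h | h
        · nlinarith
        · nlinarith
      · have : k * ‖x j‖ ^ 2 ≤ 1 := by rwa [mul_comm, ← le_div_iff₀ hk]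
        nlinarith
    have hcard : ((Finset.univ.filter fun i =>
        ‖x i‖ ^ 2 ≤ 1 / k ∧ 1 / k' < ‖x i‖ ^ 2).card : ℝ) ≤ n := by
      exact_mod_cast (Finset.card_le_univ _).trans (Fintype.card_fin n).le
    calc k * (lowMass k x - θ' - 8 / n)
        ≤ k * (∑ i with ‖x i‖ ^ 2 ≤ 1 / k ∧ 1 / k' < ‖x i‖ ^ 2, ‖x i‖ ^ 2
            - n * (8 / (n : ℝ) ^ 2)) := by
          have h1 := sub_le_sum_of_lowMass x k k'
          have h2 : (n : ℝ) * (8 / (n : ℝ) ^ 2) = 8 / n := by field_simp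
          rw [h2]
          exact mul_le_mul_of_nonneg_left (by linarith) hk.le
      _ ≤ ∑ i with ‖x i‖ ^ 2 ≤ 1 / k ∧ 1 / k' < ‖x i‖ ^ 2, k * (‖x i‖ ^ 2 - 8 / (n : ℝ) ^ 2) := by
          rw [← Finset.mul_sum, Finset.sum_sub_distrib, Finset.sum_const, nsmul_eq_mul]
          refine mul_le_mul_of_nonneg_left (sub_le_sub_left ?_ _) hk.le
          exact mul_le_mul_of_nonneg_right hcard (by positivity)
      _ ≤ ∑ i with ‖x i‖ ^ 2 ≤ 1 / k ∧ 1 / k' < ‖x i‖ ^ 2, min (k * ‖sparseVector c i‖ ^ 2) 1 :=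
          Finset.sum_le_sum hterm
      _ ≤ truncatedMass k (sparseVector c) :=
          Finset.sum_le_sum_of_subset_of_nonneg (Finset.subset_univ _)
            fun _ _ _ => le_min (by positivity) zero_le_one
  -- Large coordinates contribute only rounding error, the others exactly their own mass: `θ' + (2 /
  -- n)² ≤ (√θ' + 2 / n)²`.
  · refine abs_le_of_sq_le_sq' ?_ (by positivity) |>.2
    rw [EuclideanSpace.norm_sq_eq, ← Finset.sum_filter_add_sum_filter_not Finset.univ
      (fun i => 1 / k' < ‖x i‖ ^ 2)]
    have h1 : ∑ i ∈ I, ‖(x - sparseVector c) i‖ ^ 2 ≤ (2 / n) ^ 2 := by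
      calc _ ≤ ∑ i ∈ I, (2 / (n : ℝ) ^ 2) ^ 2 :=
            Finset.sum_le_sum fun i hi => pow_le_pow_left₀ (norm_nonneg _) (hclose i hi) 2
        _ ≤ n * (2 / (n : ℝ) ^ 2) ^ 2 := by
            rw [Finset.sum_const, nsmul_eq_mul]
            gcongr
            exact_mod_cast (Finset.card_le_univ _).trans (Fintype.card_fin n).le
        _ = (2 / n) ^ 2 * (1 / n) := by field_simp
        _ ≤ (2 / n) ^ 2 * 1 := by
            gcongr
            rw [div_le_one hn0]
            exact hn'
        _ = _ := mul_one _
    have h2 : ∑ i with ¬ 1 / k' < ‖x i‖ ^ 2, ‖(x - sparseVector c) i‖ ^ 2 ≤ θ' := by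
      refine le_trans (le_of_eq ?_) hlow
      simp only [not_lt, lowMass]
      refine Finset.sum_congr rfl fun i hi => ?_
      have : i ∉ I := by simpa [hI] using hi
      rw [PiLp.sub_apply, hc2 i this, sub_zero]
    have h3 : 0 ≤ √θ' * (2 / n) := by positivity
    have h4 := Real.sq_sqrt hθ0
    nlinarith

end

/-! ### Union bound at a single scale -/

theorem norm_toEuclideanCLM_le_of_close {n : ℕ} {A : Matrix (Fin n) (Fin n) ℂ}
    {x y : EuclideanSpace ℂ (Fin n)} {R s b : ℝ} (hA : opNorm A ≤ R)
    (hx : ‖Matrix.toEuclideanCLM (𝕜 := ℂ) A x‖ ≤ b) (hxy : ‖x - y‖ ≤ s) :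
    ‖Matrix.toEuclideanCLM (𝕜 := ℂ) A y‖ ≤ b + R * s := by
  have h1 : Matrix.toEuclideanCLM (𝕜 := ℂ) A y = Matrix.toEuclideanCLM (𝕜 := ℂ) A x
      - Matrix.toEuclideanCLM (𝕜 := ℂ) A (x - y) := by
    rw [map_sub, sub_sub_cancel]
  rw [h1]
  refine (norm_sub_le _ _).trans (add_le_add hx ?_)
  exact (ContinuousLinearMap.le_opNorm _ _).trans
    (mul_le_mul hA hxy (norm_nonneg _) ((norm_nonneg _).trans hA))

/-- The event that some unit vector with mass at least `θ` below level `1 / k` and at most `θ'`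
below level `1 / k'` has a small image. -/
def scaleEvent {Ω : Type*} {n : ℕ} (A : Ω → Matrix (Fin n) (Fin n) ℂ) (k k' θ θ' R : ℝ) : Set Ω :=
  {ω | ∃ x : EuclideanSpace ℂ (Fin n), ‖x‖ = 1 ∧ θ ≤ lowMass k x ∧ lowMass k' x ≤ θ' ∧
    ‖Matrix.toEuclideanCLM (𝕜 := ℂ) (A ω) x‖ ≤ 2 ∧ opNorm (A ω) ≤ R}

section

variable {n : ℕ} {Ω : Type*} [MeasurableSpace Ω] {P : Measure Ω} [IsProbabilityMeasure P] {δ : ℝ}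
  {A : Ω → Matrix (Fin n) (Fin n) ℂ}

theorem measure_scaleEvent_le_card_mul (hδ1 : δ < 1)
    (hA : IsSparseGaussianMatrix P δ A) (hn : 1 ≤ n)
    {k k' θ θ' R a r : ℝ} (hk : 0 < k) (hk' : 0 < k') (hθ' : θ' < 1) (ha : 0 ≤ a)
    (hak : a ≤ (n : ℝ) ^ (δ - 1) * (k * (θ - θ' - 8 / n)) / 3)
    (hr : (2 + R * (√θ' + 2 / n)) ^ 2 ≤ r) :
    P (scaleEvent A k k' θ θ' R)
      ≤ ENNReal.ofReal (((n : ℝ) * (2 * n ^ 2 + 1) ^ 2) ^ ⌊k'⌋₊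
          * Real.exp (k * r - n * (gaussianTail * (a / (1 + a))))) := by
  classical
  -- Only net points that retain enough truncated mass enter the union bound; the others have no
  -- useful small ball estimate.
  set T := (Finset.univ : Finset (Fin ⌊k'⌋₊ → Fin n × Fin (2 * n ^ 2 + 1) × Fin (2 * n ^ 2 + 1)))
    |>.filter fun c => k * (θ - θ' - 8 / n) ≤ truncatedMass k (sparseVector c) with hT
  have hcard : (T.card : ℝ) ≤ ((n : ℝ) * (2 * n ^ 2 + 1) ^ 2) ^ ⌊k'⌋₊ := by
    have : T.card ≤ (n * ((2 * n ^ 2 + 1) * (2 * n ^ 2 + 1))) ^ ⌊k'⌋₊ := by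
      refine (Finset.card_le_univ _).trans ?_
      simp
    calc (T.card : ℝ) ≤ ((n * ((2 * n ^ 2 + 1) * (2 * n ^ 2 + 1))) ^ ⌊k'⌋₊ : ℕ) := by
          exact_mod_cast this
      _ = _ := by push_cast; ring
  have hsub : scaleEvent A k k' θ θ' R
      ⊆ ⋃ c ∈ T, {ω | ‖Matrix.toEuclideanCLM (𝕜 := ℂ) (A ω) (sparseVector c)‖ ^ 2 ≤ r} := by
    rintro ω ⟨x, hx, h1, h2, h3, h4⟩
    obtain ⟨c, hc1, hc2⟩ := exists_sparseVector_approx hn hx hk hk' hθ' h2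
    simp only [Set.mem_iUnion]
    refine ⟨c, ?_, ?_⟩
    · rw [hT, Finset.mem_filter]
      refine ⟨Finset.mem_univ _, le_trans ?_ hc1⟩
      exact mul_le_mul_of_nonneg_left (by linarith) hk.le
    · exact (pow_le_pow_left₀ (norm_nonneg _)
        (norm_toEuclideanCLM_le_of_close h4 h3 hc2) 2).trans hr
  calc P (scaleEvent A k k' θ θ' R)
      ≤ ∑ c ∈ T, P {ω | ‖Matrix.toEuclideanCLM (𝕜 := ℂ) (A ω) (sparseVector c)‖ ^ 2 ≤ r} :=
        (measure_mono hsub).trans (measure_biUnion_finset_le _ _)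
    _ ≤ ∑ c ∈ T, ENNReal.ofReal (Real.exp (k * r - n * (gaussianTail * (a / (1 + a))))) := by
        refine Finset.sum_le_sum fun c hc => ?_
        refine hA.measure_norm_sq_le hδ1 hn hk.le _ ha (hak.trans ?_)
        have := (Finset.mem_filter.1 hc).2
        gcongr
    _ = ENNReal.ofReal (T.card * Real.exp (k * r - n * (gaussianTail * (a / (1 + a))))) := by
        rw [Finset.sum_const, nsmul_eq_mul, ENNReal.ofReal_mul (Nat.cast_nonneg _),
          ENNReal.ofReal_natCast]
    _ ≤ _ := ENNReal.ofReal_le_ofReal (mul_le_mul_of_nonneg_right hcard (Real.exp_pos _).le)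

/-- The exponential rate in the small ball estimate at a single scale. -/
noncomputable def scaleRate (c₂ : ℝ) : ℝ := gaussianTail / (12 * (1 + c₂))

theorem scaleRate_pos {c₂ : ℝ} (hc₂ : 0 < c₂) : 0 < scaleRate c₂ :=
  div_pos gaussianTail_pos (by positivity)

/-- The ratio between the mass thresholds of consecutive scales. -/
noncomputable def massRatio (K c₂ : ℝ) : ℝ := min (1 / 2) (scaleRate c₂ / (8 * K ^ 2))

theorem massRatio_pos {K c₂ : ℝ} (hK : 0 < K) (hc₂ : 0 < c₂) : 0 < massRatio K c₂ := by
  have := scaleRate_pos hc₂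
  exact lt_min (by norm_num) (by positivity)

theorem massRatio_le_half (K c₂ : ℝ) : massRatio K c₂ ≤ 1 / 2 := min_le_left _ _

theorem pow_card_le_exp {N k' : ℝ} (hN : 1 ≤ N) (hk' : 0 ≤ k') :
    (N * (2 * N ^ 2 + 1) ^ 2) ^ ⌊k'⌋₊ ≤ Real.exp (k' * Real.log (9 * N ^ 5)) := by
  have h9 : N * (2 * N ^ 2 + 1) ^ 2 ≤ 9 * N ^ 5 := by
    have h1 : 1 ≤ N ^ 2 := one_le_pow₀ hN
    have h2 : (2 * N ^ 2 + 1) ^ 2 ≤ (3 * N ^ 2) ^ 2 := by gcongr; linarith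
    calc _ ≤ N * (3 * N ^ 2) ^ 2 := by gcongr
      _ = _ := by ring
  have h1 : 1 ≤ 9 * N ^ 5 := by
    have : 1 ≤ N ^ 5 := one_le_pow₀ hN
    linarith
  have hpos : 0 < 9 * N ^ 5 := by linarith
  calc _ ≤ (9 * N ^ 5) ^ ⌊k'⌋₊ := by gcongr
    _ = Real.exp (⌊k'⌋₊ * Real.log (9 * N ^ 5)) := by
        rw [Real.exp_nat_mul, Real.exp_log hpos]
    _ ≤ _ := by
        refine Real.exp_le_exp.2 (mul_le_mul_of_nonneg_right (Nat.floor_le hk') ?_)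
        exact Real.log_nonneg h1

/-- This fixes the choice of `massRatio`: after `(u + v)² ≤ 2u² + 2v²`, the approximation term `2 K²
D² κ θ` is at most `scaleRate c₂ * θ * D² / 4`. The constant part takes another quarter by `hlarge`.
-/
theorem sq_image_bound {K c₂ θ D N : ℝ} (hK : 0 < K) (hc₂ : 0 < c₂) (hθ : 0 < θ) (hD : 0 ≤ D)
    (hN : 0 < N) (hDN : D ≤ N)
    (hlarge : 2 * (2 + 2 * K) ^ 2 ≤ scaleRate c₂ * θ * D ^ 2 / 4) :
    (2 + K * D * (√(massRatio K c₂ * θ) + 2 / N)) ^ 2 ≤ scaleRate c₂ * θ * D ^ 2 / 2 := by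
  have hK2 : 0 < 8 * K ^ 2 := by positivity
  have hκ : massRatio K c₂ * (8 * K ^ 2) ≤ scaleRate c₂ :=
    (le_div_iff₀ hK2).1 (min_le_right _ _)
  have hs0 : 0 ≤ √(massRatio K c₂ * θ) := Real.sqrt_nonneg _
  have h0 : 0 ≤ massRatio K c₂ * θ := mul_nonneg (massRatio_pos hK hc₂).le hθ.le
  have hs := Real.sq_sqrt h0
  have h1 : K * D * (2 / N) ≤ 2 * K := by
    have : D * (2 / N) ≤ 2 := by
      rw [mul_div_assoc', div_le_iff₀ hN]
      linarith
    nlinarith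
  have h2 : 2 + K * D * (√(massRatio K c₂ * θ) + 2 / N)
      ≤ (2 + 2 * K) + K * D * √(massRatio K c₂ * θ) := by linarith
  have h3 : 0 ≤ 2 + K * D * (√(massRatio K c₂ * θ) + 2 / N) := by positivity
  calc _ ≤ ((2 + 2 * K) + K * D * √(massRatio K c₂ * θ)) ^ 2 := pow_le_pow_left₀ h3 h2 2
    _ ≤ 2 * (2 + 2 * K) ^ 2 + 2 * (K * D * √(massRatio K c₂ * θ)) ^ 2 := by
        nlinarith [sq_nonneg ((2 + 2 * K) - K * D * √(massRatio K c₂ * θ))]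
    _ = 2 * (2 + 2 * K) ^ 2 + massRatio K c₂ * (8 * K ^ 2) * (θ * D ^ 2 / 4) := by
        rw [mul_pow, mul_pow, hs]; ring
    _ ≤ 2 * (2 + 2 * K) ^ 2 + scaleRate c₂ * (θ * D ^ 2 / 4) := by gcongr
    _ ≤ _ := by linarith

/-- The estimate at a single scale. -/
theorem measure_scaleEvent_le (hδ0 : 0 < δ) (hδ1 : δ < 1) {K c₂ : ℝ} (hK : 0 < K) (hc₂ : 0 < c₂)
    (hA : IsSparseGaussianMatrix P δ A) (hn : 1 ≤ n) {k k' θ : ℝ} (hθ0 : 0 < θ) (hθ1 : θ ≤ 1)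
    (hk : 1 ≤ k) (hk' : 0 < k') (hkc : k ≤ c₂ * (n : ℝ) ^ (1 - δ))
    (hkk' : k' ≤ k * (n : ℝ) ^ (δ / 2)) (hn32 : 32 ≤ θ * n)
    (hlarge : 2 * (2 + 2 * K) ^ 2 ≤ scaleRate c₂ * θ * (n : ℝ) ^ δ / 4)
    (hlog : (n : ℝ) ^ (δ / 2) * Real.log (9 * (n : ℝ) ^ 5) ≤ scaleRate c₂ * θ * (n : ℝ) ^ δ / 4) :
    P (scaleEvent A k k' θ (massRatio K c₂ * θ) (K * (n : ℝ) ^ (δ / 2)))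
      ≤ ENNReal.ofReal (Real.exp (-(scaleRate c₂ * θ / 4 * (n : ℝ) ^ δ))) := by
  have hn' : (1 : ℝ) ≤ n := by exact_mod_cast hn
  have hn0 : (0 : ℝ) < n := by linarith
  have hk0 : 0 < k := by linarith
  have hD2 : ((n : ℝ) ^ (δ / 2)) ^ 2 = (n : ℝ) ^ δ := by
    rw [← Real.rpow_natCast, ← Real.rpow_mul hn0.le]
    congr 1
    push_cast
    ring
  have hDN : (n : ℝ) ^ (δ / 2) ≤ n := by
    calc (n : ℝ) ^ (δ / 2) ≤ (n : ℝ) ^ (1 : ℝ) :=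
          Real.rpow_le_rpow_of_exponent_le hn' (by linarith)
      _ = n := Real.rpow_one _
  have hp0 : 0 < (n : ℝ) ^ (δ - 1) := by positivity
  have hnp : (n : ℝ) * (n : ℝ) ^ (δ - 1) = (n : ℝ) ^ δ := by
    rw [← Real.rpow_one_add' hn0.le (by linarith)]
    congr 1
    ring
  have hpc : (n : ℝ) ^ (δ - 1) * k ≤ c₂ := by
    calc _ ≤ (n : ℝ) ^ (δ - 1) * (c₂ * (n : ℝ) ^ (1 - δ)) := by gcongr
      _ = c₂ * ((n : ℝ) ^ (δ - 1) * (n : ℝ) ^ (1 - δ)) := by ring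
      _ = c₂ := by
          rw [← Real.rpow_add hn0]
          simp
  have hκ := massRatio_le_half K c₂
  have hc3 := scaleRate_pos hc₂
  have hκθ : massRatio K c₂ * θ ≤ θ / 2 := by nlinarith
  -- Of the mass `θ`, at most `θ / 2` is lost below level `1 / k'` and `θ / 4` to rounding; the
  -- remaining `θ / 4`, divided by `3`, gives the `12`. The cap on `k` yields `a ≤ c₂`, so `a / (1 +
  -- a)` stays linear in `a`.
  set a : ℝ := (n : ℝ) ^ (δ - 1) * k * θ / 12 with ha
  have ha0 : 0 ≤ a := by positivity
  have hac : a ≤ c₂ := by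
    have : (n : ℝ) ^ (δ - 1) * k * θ ≤ c₂ * 1 := by gcongr
    have h0 : 0 ≤ (n : ℝ) ^ (δ - 1) * k * θ := by positivity
    linarith
  have hak : a ≤ (n : ℝ) ^ (δ - 1) * (k * (θ - massRatio K c₂ * θ - 8 / n)) / 3 := by
    have h8 : 8 / (n : ℝ) ≤ θ / 4 := by
      rw [div_le_iff₀ hn0]
      linarith
    have h1 : θ / 4 ≤ θ - massRatio K c₂ * θ - 8 / n := by linarith
    calc a = (n : ℝ) ^ (δ - 1) * (k * (θ / 4)) / 3 := by rw [ha]; ring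
      _ ≤ _ := by gcongr
  rw [← hD2] at hlarge
  have hr := sq_image_bound hK hc₂ hθ0 (by positivity) hn0 hDN hlarge
  refine (measure_scaleEvent_le_card_mul hδ1 hA hn hk0 hk' (by linarith) ha0 hak hr).trans ?_
  refine ENNReal.ofReal_le_ofReal ?_
  refine (mul_le_mul_of_nonneg_right (pow_card_le_exp hn' hk'.le) (Real.exp_pos _).le).trans ?_
  rw [← Real.exp_add]
  refine Real.exp_le_exp.2 ?_
  rw [hD2]
  have h9 : 0 ≤ Real.log (9 * (n : ℝ) ^ 5) := by
    refine Real.log_nonneg ?_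
    have : (1 : ℝ) ≤ (n : ℝ) ^ 5 := one_le_pow₀ hn'
    linarith
  have e1 : k' * Real.log (9 * (n : ℝ) ^ 5) ≤ k * (scaleRate c₂ * θ * (n : ℝ) ^ δ / 4) := by
    calc _ ≤ k * (n : ℝ) ^ (δ / 2) * Real.log (9 * (n : ℝ) ^ 5) := by gcongr
      _ = k * ((n : ℝ) ^ (δ / 2) * Real.log (9 * (n : ℝ) ^ 5)) := by ring
      _ ≤ _ := by gcongr
  have e2 : k * (scaleRate c₂ * θ * (n : ℝ) ^ δ) ≤ n * (gaussianTail * (a / (1 + a))) := by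
    have hq := gaussianTail_pos
    calc k * (scaleRate c₂ * θ * (n : ℝ) ^ δ) = n * (gaussianTail * (a / (1 + c₂))) := by
          rw [ha, scaleRate, ← hnp]
          field_simp
      _ ≤ _ := by gcongr
  have e3 : 0 ≤ (k - 1) * (scaleRate c₂ * θ * (n : ℝ) ^ δ) :=
    mul_nonneg (by linarith) (by positivity)
  -- In units of `k * scaleRate c₂ * θ * n ^ δ`, the gain is `1`, the Markov factor costs `1 / 2`
  -- and the net `1 / 4`. The last quarter remains, and `k ≥ 1`.
  nlinarith

end

/-! ### Chaining the scales -/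

theorem exists_crossing (f : ℕ → ℝ) (θ : ℕ → ℝ) {S : ℕ} (h0 : θ 0 ≤ f 0) (hS : f S < θ S) :
    ∃ s < S, θ s ≤ f s ∧ f (s + 1) < θ (s + 1) := by
  by_contra! h
  have : ∀ s ≤ S, θ s ≤ f s := by
    intro s
    induction s with
    | zero => exact fun _ => h0
    | succ s ih => exact fun hs => h s (by omega) (ih (by omega))
  exact absurd (this S le_rfl) (not_le.2 hS)

theorem lowMass_one_eq_one {n : ℕ} {x : EuclideanSpace ℂ (Fin n)} (hx : ‖x‖ = 1) :
    lowMass 1 x = 1 := by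
  rw [lowMass, Finset.filter_true_of_mem, ← EuclideanSpace.norm_sq_eq, hx, one_pow]
  intro i _
  rw [div_one]
  exact pow_le_one₀ (norm_nonneg _) (norm_coord_le_one hx i)

/-- The `s`-th sparsity scale. -/
noncomputable def scale (δ c₂ : ℝ) (n s : ℕ) : ℝ :=
  min (((n : ℝ) ^ (δ / 2)) ^ s) (c₂ * (n : ℝ) ^ (1 - δ))

theorem scale_succ_le {δ c₂ : ℝ} {n : ℕ} (s : ℕ) (h1 : 1 ≤ (n : ℝ) ^ (δ / 2))
    (h2 : 0 ≤ c₂ * (n : ℝ) ^ (1 - δ)) :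
    scale δ c₂ n (s + 1) ≤ scale δ c₂ n s * (n : ℝ) ^ (δ / 2) := by
  unfold scale
  rw [min_mul_of_nonneg _ _ (by linarith), pow_succ]
  exact min_le_min le_rfl (le_mul_of_one_le_right h2 h1)

theorem eventually_rpow_mul_log_le {δ b : ℝ} (hδ : 0 < δ) (hb : 0 < b) :
    ∀ᶠ n : ℕ in Filter.atTop,
      (n : ℝ) ^ (δ / 2) * Real.log (9 * (n : ℝ) ^ 5) ≤ b * (n : ℝ) ^ δ := by
  have h1 := (isLittleO_log_rpow_atTop (half_pos hδ)).def (show 0 < b / 10 by positivity)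
  have h2 := (tendsto_rpow_atTop (half_pos hδ)).eventually_ge_atTop (2 * Real.log 9 / b)
  have h := ((h1.and h2).and (Filter.eventually_ge_atTop (1 : ℝ)))
  filter_upwards [tendsto_natCast_atTop_atTop.eventually h] with n hn
  obtain ⟨⟨hn1, hn2⟩, hn3⟩ := hn
  have hn0 : (0 : ℝ) < n := by linarith
  have hpos : 0 < (n : ℝ) ^ (δ / 2) := by positivity
  have hD2 : (n : ℝ) ^ δ = (n : ℝ) ^ (δ / 2) * (n : ℝ) ^ (δ / 2) := by
    rw [← Real.rpow_add hn0, add_halves]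
  rw [Real.norm_of_nonneg (Real.log_nonneg hn3), Real.norm_of_nonneg hpos.le] at hn1
  rw [div_le_iff₀ hb] at hn2
  rw [Real.log_mul (by norm_num) (by positivity), Real.log_pow, hD2]
  have : Real.log 9 + (5 : ℕ) * Real.log n ≤ b * (n : ℝ) ^ (δ / 2) := by
    push_cast
    linarith
  nlinarith

theorem tendsto_natCast_rpow_atTop {a : ℝ} (ha : 0 < a) :
    Filter.Tendsto (fun n : ℕ => (n : ℝ) ^ a) Filter.atTop Filter.atTop :=
  (tendsto_rpow_atTop ha).comp tendsto_natCast_atTop_atTop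

/-- Since `ε ≤ 1 < 2`, some vector has image of norm below `2`, whether or not the infimum is
attained. This is also why nothing later depends on `ε`. The scale `s` is where the low mass first
falls below its threshold. -/
theorem setOf_infNorm_le_subset {Ω : Type*} {n : ℕ} (A : Ω → Matrix (Fin n) (Fin n) ℂ)
    (κ : ℝ) {δ c₂ ε₁ ε₂ ε R : ℝ} {S : ℕ} (hε : ε ≤ 1) (hκ : ε₁ + ε₂ ≤ κ ^ S)
    (h0 : scale δ c₂ n 0 = 1) (hS : scale δ c₂ n S = c₂ * (n : ℝ) ^ (1 - δ)) :
    {ω | infNorm (A ω) (highlyCompressible δ c₂ ε₁ ε₂ n) ≤ ENNReal.ofReal ε ∧ opNorm (A ω) ≤ R}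
      ⊆ ⋃ s ∈ Finset.range S,
        scaleEvent A (scale δ c₂ n s) (scale δ c₂ n (s + 1)) (κ ^ s) (κ * κ ^ s) R := by
  rintro ω ⟨h1, h2⟩
  have h3 : infNorm (A ω) (highlyCompressible δ c₂ ε₁ ε₂ n) < ENNReal.ofReal 2 :=
    h1.trans_lt ((ENNReal.ofReal_lt_ofReal_iff two_pos).2 (by linarith))
  simp only [infNorm, iInf_lt_iff] at h3
  obtain ⟨x, ⟨hx1, hx2⟩, hx3⟩ := h3
  rw [← ofReal_norm, ENNReal.ofReal_lt_ofReal_iff two_pos] at hx3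
  obtain ⟨s, hs, hs1, hs2⟩ := exists_crossing (fun s => lowMass (scale δ c₂ n s) x)
    (fun s => κ ^ s) (S := S) (by simp only [h0, lowMass_one_eq_one hx1, pow_zero, le_refl])
    (by simp only [hS]; exact hx2.trans_le hκ)
  simp only [Set.mem_iUnion]
  refine ⟨s, Finset.mem_range.2 hs, x, hx1, hs1, ?_, hx3.le, h2⟩
  rw [← pow_succ']
  exact hs2.le

theorem theorem5 (δ : ℝ) (hδ0 : 0 < δ) (hδ1 : δ < 1) (K : ℝ) (hK : 0 < K)
    (c₂ : ℝ) (hc₂ : 0 < c₂) :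
    ∃ ε₀ : ℝ, 0 < ε₀ ∧ ∀ ε₁ ε₂ : ℝ, 0 < ε₁ → 0 < ε₂ → ε₁ + ε₂ ≤ ε₀ →
      ∃ c : ℝ, 0 < c ∧ ∃ N : ℕ, ∀ n : ℕ, N ≤ n →
        ∀ (Ω : Type*) [MeasurableSpace Ω] (P : Measure Ω) [IsProbabilityMeasure P]
          (A : Ω → Matrix (Fin n) (Fin n) ℂ), IsSparseGaussianMatrix P δ A →
        ∀ ε : ℝ, 0 ≤ ε → ε ≤ 1 →
          P {ω | infNorm (A ω) (highlyCompressible δ c₂ ε₁ ε₂ n) ≤ ENNReal.ofReal ε ∧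
              opNorm (A ω) ≤ K * (n : ℝ) ^ (δ / 2)}
            ≤ ENNReal.ofReal (Real.exp (-c * (n : ℝ) ^ δ)) := by
  -- `S ≥ 2 / δ` makes `(n ^ (δ / 2)) ^ S ≥ n`, which exceeds the cap `c₂ n ^ (1 - δ)` once `n ^ δ ≥
  -- c₂`.
  obtain ⟨S, hS⟩ := exists_nat_ge (2 / δ)
  set κ := massRatio K c₂ with hκdef
  have hκ0 : 0 < κ := massRatio_pos hK hc₂
  have hκ1 : κ ≤ 1 := (massRatio_le_half K c₂).trans (by norm_num)
  have hrate := scaleRate_pos hc₂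
  have hκS : 0 < κ ^ S := pow_pos hκ0 S
  -- The threshold `κ ^ S` is the mass allowed at the last scale. The rate is half the single-scale
  -- rate; the other half absorbs the factor `S` of the union bound.
  refine ⟨κ ^ S, hκS, fun ε₁ ε₂ _ _ hε₁₂ => ⟨scaleRate c₂ * κ ^ S / 8, by positivity, ?_⟩⟩
  have hb : 0 < scaleRate c₂ * κ ^ S / 4 := by positivity
  -- All largeness conditions are imposed at the smallest threshold `κ ^ S`, so they serve every
  -- scale at once.
  have ev1 := (tendsto_natCast_atTop_atTop (R := ℝ)).eventually_ge_atTop (32 / κ ^ S)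
  have ev2 := (tendsto_natCast_rpow_atTop hδ0).eventually_ge_atTop
    (2 * (2 + 2 * K) ^ 2 / (scaleRate c₂ * κ ^ S / 4))
  have ev3 := eventually_rpow_mul_log_le hδ0 hb
  have ev4 := (tendsto_natCast_rpow_atTop (sub_pos.2 hδ1)).eventually_ge_atTop (1 / c₂)
  have ev5 := (tendsto_natCast_rpow_atTop hδ0).eventually_ge_atTop c₂
  have ev6 := (tendsto_natCast_rpow_atTop hδ0).eventually_ge_atTop
    (S / (scaleRate c₂ * κ ^ S / 8))
  obtain ⟨N, hN⟩ := Filter.eventually_atTop.1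
    (ev1.and (ev2.and (ev3.and (ev4.and (ev5.and (ev6.and (Filter.eventually_ge_atTop 1)))))))
  refine ⟨N, fun n hn Ω _ P _ A hA ε _ hε1 => ?_⟩
  obtain ⟨h1, h2, h3, h4, h5, h6, h7⟩ := hN n hn
  have hn' : (1 : ℝ) ≤ n := by exact_mod_cast h7
  have hn0 : (0 : ℝ) < n := by linarith
  rw [div_le_iff₀ hκS] at h1
  rw [div_le_iff₀ hb] at h2
  rw [div_le_iff₀ hc₂] at h4
  rw [div_le_iff₀ (by positivity)] at h6
  have hm1 : 1 ≤ c₂ * (n : ℝ) ^ (1 - δ) := by linarith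
  have hD1 : 1 ≤ (n : ℝ) ^ (δ / 2) := Real.one_le_rpow hn' (by linarith)
  have hscale0 : scale δ c₂ n 0 = 1 := by
    rw [scale, pow_zero, min_eq_left hm1]
  have hscaleS : scale δ c₂ n S = c₂ * (n : ℝ) ^ (1 - δ) := by
    refine min_eq_right ?_
    calc c₂ * (n : ℝ) ^ (1 - δ) ≤ (n : ℝ) ^ δ * (n : ℝ) ^ (1 - δ) := by gcongr
      _ = (n : ℝ) ^ (1 : ℝ) := by
          rw [← Real.rpow_add hn0]
          congr 1
          ring
      _ ≤ (n : ℝ) ^ (δ / 2 * S) := by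
          refine Real.rpow_le_rpow_of_exponent_le hn' ?_
          rw [div_le_iff₀ hδ0] at hS
          linarith
      _ = ((n : ℝ) ^ (δ / 2)) ^ S := by rw [Real.rpow_mul hn0.le, Real.rpow_natCast]
  have hscale1 : ∀ s, 1 ≤ scale δ c₂ n s := fun s => le_min (one_le_pow₀ hD1) hm1
  refine (measure_mono (setOf_infNorm_le_subset A κ hε1 hε₁₂ hscale0 hscaleS)).trans ?_
  refine (measure_biUnion_finset_le _ _).trans ?_
  have hstep : ∀ s ∈ Finset.range S,
      P (scaleEvent A (scale δ c₂ n s) (scale δ c₂ n (s + 1)) (κ ^ s) (κ * κ ^ s)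
        (K * (n : ℝ) ^ (δ / 2)))
      ≤ ENNReal.ofReal (Real.exp (-(scaleRate c₂ * κ ^ S / 4 * (n : ℝ) ^ δ))) := by
    intro s hs
    have hsS : κ ^ S ≤ κ ^ s := pow_le_pow_of_le_one hκ0.le hκ1 (Finset.mem_range.1 hs).le
    have hmono : scaleRate c₂ * κ ^ S / 4 * (n : ℝ) ^ δ
        ≤ scaleRate c₂ * κ ^ s / 4 * (n : ℝ) ^ δ := by gcongr
    refine (measure_scaleEvent_le hδ0 hδ1 hK hc₂ hA h7 (pow_pos hκ0 s)
      (pow_le_one₀ hκ0.le hκ1) (hscale1 s) (zero_lt_one.trans_le (hscale1 _)) (min_le_right _ _)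
      (scale_succ_le s hD1 (by linarith)) ?_ ?_ ?_).trans ?_
    · nlinarith
    · linarith
    · linarith
    · exact ENNReal.ofReal_le_ofReal (Real.exp_le_exp.2 (neg_le_neg hmono))
  refine (Finset.sum_le_sum hstep).trans ?_
  rw [Finset.sum_const, nsmul_eq_mul, Finset.card_range, ← ENNReal.ofReal_natCast,
    ← ENNReal.ofReal_mul (Nat.cast_nonneg _)]
  refine ENNReal.ofReal_le_ofReal ?_
  have hSexp : (S : ℝ) ≤ Real.exp (scaleRate c₂ * κ ^ S / 8 * (n : ℝ) ^ δ) := by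
    have := Real.add_one_le_exp (scaleRate c₂ * κ ^ S / 8 * (n : ℝ) ^ δ)
    linarith
  refine (mul_le_mul_of_nonneg_right hSexp (Real.exp_pos _).le).trans ?_
  rw [← Real.exp_add]
  refine Real.exp_le_exp.2 (le_of_eq ?_)
  ring
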